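/- Call an infinite cardinal $\kappa$ *measurable* if there is a nonprincipal ultrafilter on a set of cardinality $\kappa$ which is closed under intersections of families of fewer than $\kappa$ of its members. (With this convention $\aleph_0$ is measurable.) Let $k$ be a field of characteristic $0$, and let $(A_i)_{i\in I}$ be a family of solvable Lie algebras over $k$, of arbitrary (possibly infinite) dimensions, indexed by an arbitrary set $I$. Consider the condition $(*)$ if there exists a measurable cardinal greater than $\operatorname{card}(k)$, then either $\operatorname{card}(I)$ is less than every such cardinal, or $\sup_{i\in I}\dim_k A_i$ is less than every such cardinal. Then: 1. If $(*)$ holds, then every finite-dimensional Lie algebra $B$ over $k$ that is the image of a surjective Lie algebra homomorphism $\prod_{i\in I}A_i\to B$ from the full direct product is solvable. 2. Condition $(*)$ holds automatically if $\dim_k A_i\le 2^{\aleph_0}$ for all $i\in I$; in particular, it holds if all the $A_i$ are finite-dimensional. -/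

import Mathlib

universe u v w x

/-- The direct product of a family of Lie rings, with componentwise bracket. -/
instance piLieRing {I : Type u} (A : I → Type w) [∀ i, LieRing (A i)] :
    LieRing (∀ i, A i) where
  bracket x y := fun i => ⁅x i, y i⁆
  add_lie x y z := funext fun i => add_lie (x i) (y i) (z i)
  lie_add x y z := funext fun i => lie_add (x i) (y i) (z i)
  lie_self x := funext fun i => lie_self (x i)
  leibniz_lie x y z := funext fun i => leibniz_lie (x i) (y i) (z i)

/-- The direct product of a family of Lie algebras over `k`, with componentwise operations. -/
instance piLieAlgebra (k : Type v) [CommRing k] {I : Type u} (A : I → Type w)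
    [∀ i, LieRing (A i)] [∀ i, LieAlgebra k (A i)] : LieAlgebra k (∀ i, A i) where
  lie_smul c x y := funext fun i => lie_smul c (x i) (y i)

/-- An infinite cardinal `κ` is measurable if there is a nonprincipal `κ`-complete ultrafilter on
(a set of cardinality) `κ`; here `κ`-complete means closed under intersections of families of fewer
than `κ` members. With this convention `ℵ₀` is measurable. -/
def Cardinal.IsMeasurable (κ : Cardinal.{u}) : Prop :=
  Cardinal.aleph0 ≤ κ ∧ ∃ U : Ultrafilter κ.out,
    (∀ x : κ.out, U ≠ pure x) ∧ CardinalInterFilter (U : Filter κ.out) κ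

/-- If there is a measurable cardinal greater than `card k`, then either `card I` or the supremum of
the dimensions of the `A i` is less than every such cardinal. All cardinals are lifted to a common
universe, in which the supremum is that of a bounded family. -/
def SmallIndexOrDimensions (k : Type v) [Field k] {I : Type u} (A : I → Type w)
    [∀ i, LieRing (A i)] [∀ i, LieAlgebra k (A i)] : Prop :=
  (∃ μ : Cardinal.{max u v w},
      μ.IsMeasurable ∧ Cardinal.lift.{max u w} (Cardinal.mk k) < μ) →
    ((∀ μ : Cardinal.{max u v w}, μ.IsMeasurable →
        Cardinal.lift.{max u w} (Cardinal.mk k) < μ →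
          Cardinal.lift.{max v w} (Cardinal.mk I) < μ) ∨
      (∀ μ : Cardinal.{max u v w}, μ.IsMeasurable →
        Cardinal.lift.{max u w} (Cardinal.mk k) < μ →
          (⨆ i, Cardinal.lift.{max u v} (Module.rank k (A i))) < μ))

/-! Let `r i` bound the derived length of `A i`. For `a` in the product, the elements `p(r) • a`
with `p` a polynomial map linearly to a finite-dimensional space, so some `p ≠ 0` gives `f (p(r) •
a) = 0` (`exists_polynomial_map_smul_eq_zero`). Off the set `J` where `p(r i) = 0`, the factor `p(r
i)` can be moved across the bracket, so `f ⁅a, c⁆` depends only on the part of `c` supported on `J`.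
In characteristic zero `r` is bounded on `J`, so that part maps into a solvable ideal. Hence `⁅B,
B⁆` lies in the radical. The cardinal condition holds in small dimensions because uncountable
measurable cardinals exceed the continuum. -/

namespace LieAlgebra

section Product

variable {k : Type v} [CommRing k] {I : Type u} (A : I → Type w)
  [∀ i, LieRing (A i)] [∀ i, LieAlgebra k (A i)]

variable (k) in
/-- The projection of a direct product of Lie algebras onto one factor. -/
def piProj (i : I) : (∀ i, A i) →ₗ⁅k⁆ A i where
  toLinearMap := LinearMap.proj i
  map_lie' := rfl

variable (k) in
/-- The ideal of those elements of a direct product of Lie algebras that vanish outside `J`. -/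
def piSupported (J : Set I) : LieIdeal k (∀ i, A i) where
  carrier := {x | ∀ i ∉ J, x i = 0}
  add_mem' hx hy i hi := by simp [hx i hi, hy i hi]
  zero_mem' _ _ := rfl
  smul_mem' c x hx i hi := by simp [hx i hi]
  lie_mem {x y} hy i hi := by
    change ⁅x i, y i⁆ = 0
    rw [hy i hi, lie_zero]

theorem apply_mem_derivedSeries_of_mem {n : ℕ} {x : ∀ i, A i}
    (hx : x ∈ derivedSeries k (∀ i, A i) n) (i : I) : x i ∈ derivedSeries k (A i) n :=
  LieIdeal.derivedSeries_map_le (f := piProj k A i) n (LieIdeal.mem_map hx)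

/-- If the derived lengths are bounded by `n` on `J`, then the elements supported on `J` form an
ideal of derived length at most `n`. -/
theorem derivedSeriesOfIdeal_piSupported_eq_bot {J : Set I} {n : ℕ}
    (h : ∀ i ∈ J, derivedSeries k (A i) n = ⊥) :
    derivedSeriesOfIdeal k (∀ i, A i) n (piSupported k A J) = ⊥ := by
  rw [eq_bot_iff]
  intro x hx
  rw [LieSubmodule.mem_bot]
  funext i
  by_cases hi : i ∈ J
  · have := apply_mem_derivedSeries_of_mem A (derivedSeriesOfIdeal_mono le_top n hx) i
    rwa [h i hi, LieSubmodule.mem_bot] at this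
  · exact derivedSeriesOfIdeal_le_self _ n hx i hi

end Product

variable {k : Type v} [CommRing k]

theorem derivedSeriesOfIdeal_map_eq {L : Type*} {B : Type*} [LieRing L] [LieAlgebra k L]
    [LieRing B] [LieAlgebra k B] {f : L →ₗ⁅k⁆ B} (hf : Function.Surjective f)
    (K : LieIdeal k L) (n : ℕ) :
    derivedSeriesOfIdeal k B n (K.map f) = (derivedSeriesOfIdeal k L n K).map f := by
  induction n with
  | zero => rfl
  | succ n ih =>
    rw [derivedSeriesOfIdeal_succ, derivedSeriesOfIdeal_succ, ih, LieIdeal.map_bracket_eq f hf]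

/-- One step of the derived series lands in `K`, and `n` more steps kill `K`. -/
theorem isSolvable_of_lie_mem {B : Type*} [LieRing B] [LieAlgebra k B] (K : LieIdeal k B)
    [IsSolvable K] (h : ∀ x y : B, ⁅x, y⁆ ∈ K) : IsSolvable B := by
  obtain ⟨n, hn⟩ := IsSolvable.solvable k K
  rw [LieIdeal.derivedSeries_eq_bot_iff] at hn
  have h1 : derivedSeriesOfIdeal k B 1 ⊤ ≤ K := by
    rw [derivedSeriesOfIdeal_succ, derivedSeriesOfIdeal_zero, LieSubmodule.lie_le_iff]
    exact fun x _ y _ => h x y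
  refine IsSolvable.mk (R := k) (k := n + 1) ?_
  rw [derivedSeries_def, derivedSeriesOfIdeal_add, eq_bot_iff, ← hn]
  exact derivedSeriesOfIdeal_mono h1 n

/-- For every function `r : I → k` and every `a` in the product, a linear
map to a finite-dimensional space kills `p(r) • a` for some nonzero polynomial `p`. -/
theorem exists_polynomial_map_smul_eq_zero {k : Type v} [Field k] {I : Type u} {A : I → Type w}
    [∀ i, AddCommGroup (A i)] [∀ i, Module k (A i)] {B : Type*} [AddCommGroup B] [Module k B]
    [FiniteDimensional k B] (f : (∀ i, A i) →ₗ[k] B) (r : I → k) (a : ∀ i, A i) :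
    ∃ p : Polynomial k, p ≠ 0 ∧ f (fun i => p.eval (r i) • a i) = 0 := by
  let g : Polynomial k →ₗ[k] B := f ∘ₗ
    { toFun := fun p i => p.eval (r i) • a i
      map_add' := fun p q => funext fun i => by simp [add_smul]
      map_smul' := fun c p => funext fun i => by simp [mul_smul] }
  by_contra! h
  -- Otherwise `k[X]`, which is infinite-dimensional, would embed in `B`.
  have hg : Function.Injective g :=
    (injective_iff_map_eq_zero g).2 fun p hp => by_contra fun h0 => h p h0 hp
  exact Polynomial.not_finite (R := k) (FiniteDimensional.of_injective g hg)

/-- A finite-dimensional homomorphic image of a direct product of solvable Lie algebras over a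
field of characteristic zero is solvable. -/
theorem isSolvable_of_surjective_pi {k : Type v} [Field k] [CharZero k] {I : Type u}
    (A : I → Type w) [∀ i, LieRing (A i)] [∀ i, LieAlgebra k (A i)] (hA : ∀ i, IsSolvable (A i))
    {B : Type x} [LieRing B] [LieAlgebra k B] [FiniteDimensional k B]
    (f : (∀ i, A i) →ₗ⁅k⁆ B) (hf : Function.Surjective f) : IsSolvable B := by
  classical
  choose r hr using fun i => IsSolvable.solvable k (A i)
  refine isSolvable_of_lie_mem (radical k B) fun b b' => ?_
  obtain ⟨a, rfl⟩ := hf b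
  obtain ⟨c, rfl⟩ := hf b'
  obtain ⟨p, hp, hpa⟩ := exists_polynomial_map_smul_eq_zero (f : (∀ i, A i) →ₗ[k] B)
    (fun i => (r i : k)) a
  let J : Set I := {i | p.eval (r i : k) = 0}
  obtain ⟨N, hN⟩ : ∃ N, ∀ i ∈ J, r i ≤ N := by
    have hfin : {n : ℕ | p.eval (n : k) = 0}.Finite :=
      (Polynomial.finite_setOfPred_isRoot hp).preimage Nat.cast_injective.injOn
    obtain ⟨N, hN⟩ := hfin.bddAbove
    exact ⟨N, fun i hi => hN hi⟩
  have hJ : (piSupported k A J).map f ≤ radical k B := by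
    rw [← LieIdeal.solvable_iff_le_radical]
    refine IsSolvable.mk (R := k) (k := N) ?_
    rw [LieIdeal.derivedSeries_eq_bot_iff, derivedSeriesOfIdeal_map_eq hf,
      derivedSeriesOfIdeal_piSupported_eq_bot A, LieIdeal.map_eq_bot_iff]
    · exact bot_le
    intro i hi
    rw [eq_bot_iff, ← hr i]
    exact derivedSeriesOfIdeal_antitone _ (hN i hi)
  let c₁ : ∀ i, A i := fun i => if i ∈ J then c i else 0
  -- On `J` the inverse is `0⁻¹ = 0`, so `c₂` vanishes there and `c₁` carries `c`.
  let c₂ : ∀ i, A i := fun i => (p.eval (r i : k))⁻¹ • c i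
  have hc : ⁅a, c⁆ = ⁅a, c₁⁆ + ⁅(fun i => p.eval (r i : k) • a i : ∀ i, A i), c₂⁆ := by
    funext i
    change ⁅a i, c i⁆ = ⁅a i, c₁ i⁆ + ⁅p.eval (r i : k) • a i, c₂ i⁆
    by_cases hi : p.eval (r i : k) = 0
    · simp [c₁, c₂, J, hi]
    · simp [c₁, c₂, J, hi, smul_smul]
  have hpa' : f (fun i => p.eval (r i : k) • a i) = 0 := hpa
  rw [← LieHom.map_lie, hc, map_add, LieHom.map_lie, LieHom.map_lie, hpa', zero_lie, add_zero]
  refine lie_mem_right k B _ _ _ (hJ (LieIdeal.mem_map ?_))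
  intro i hi
  exact if_neg hi

end LieAlgebra

/-- A countably complete ultrafilter on a set of at most continuum many points is principal. -/
theorem Ultrafilter.exists_eq_pure_of_mk_le_continuum {α : Type u} (U : Ultrafilter α)
    [CountableInterFilter (U : Filter α)] (hα : Cardinal.mk α ≤ Cardinal.continuum) :
    ∃ x, U = pure x := by
  have hα' : Cardinal.lift.{0} (Cardinal.mk α) ≤ Cardinal.lift.{u} (Cardinal.mk (Set ℕ)) := by
    simpa using hα
  obtain ⟨e⟩ := Cardinal.lift_mk_le'.1 hα'
  -- View points as subsets of `ℕ`. For each `n`, membership of `n` is constant on a set in `U`; the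
  -- intersection over all `n` has at most one point.
  have hsep (n : ℕ) : {x | n ∈ e x ↔ {y | n ∈ e y} ∈ U} ∈ (U : Filter α) := by
    by_cases h : {y | n ∈ e y} ∈ U
    · simp [h]
    · simp only [h, iff_false]
      exact Ultrafilter.compl_mem_iff_notMem.2 h
  have hmem := countable_iInter_mem.2 hsep
  have hsub : (⋂ n, {x | n ∈ e x ↔ {y | n ∈ e y} ∈ U}).Finite := by
    refine Set.Subsingleton.finite fun x hx y hy => e.injective (Set.ext fun n => ?_)
    exact (Set.mem_iInter.1 hx n).trans (Set.mem_iInter.1 hy n).symm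
  obtain ⟨x, -, hx⟩ := Ultrafilter.eq_pure_of_finite_mem hsub hmem
  exact ⟨x, hx⟩

/-- Uncountable measurable cardinals exceed the continuum. -/
theorem Cardinal.IsMeasurable.continuum_lt {μ : Cardinal.{u}} (h : μ.IsMeasurable)
    (hμ : Cardinal.aleph0 < μ) : Cardinal.continuum < μ := by
  obtain ⟨-, U, hU, hc⟩ := h
  by_contra! hle
  have : CountableInterFilter (U : Filter μ.out) := hc.toCountableInterFilter _ hμ
  obtain ⟨x, hx⟩ := U.exists_eq_pure_of_mk_le_continuum (by rwa [Cardinal.mk_out])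
  exact hU x hx

theorem smallIndexOrDimensions_of_rank_le_continuum {k : Type v} [Field k] [Infinite k]
    {I : Type u} (A : I → Type w) [∀ i, LieRing (A i)] [∀ i, LieAlgebra k (A i)]
    (h : ∀ i, Module.rank k (A i) ≤ Cardinal.continuum) : SmallIndexOrDimensions k A := by
  refine fun _ => Or.inr fun μ hμ hk => ?_
  -- An infinite `k` excludes `μ = ℵ₀`, which counts as measurable here.
  have hω : Cardinal.aleph0 < μ :=
    lt_of_le_of_lt (Cardinal.aleph0_le_lift.2 (Cardinal.aleph0_le_mk k)) hk
  refine lt_of_le_of_lt (ciSup_le' fun i => ?_) (hμ.continuum_lt hω)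
  simpa using h i

theorem corollary5p3 {k : Type v} [Field k] [CharZero k] {I : Type u} (A : I → Type w)
    [∀ i, LieRing (A i)] [∀ i, LieAlgebra k (A i)] (hA : ∀ i, LieAlgebra.IsSolvable (A i)) :
    (SmallIndexOrDimensions k A →
      ∀ (B : Type x) [LieRing B] [LieAlgebra k B] [FiniteDimensional k B]
        (f : (∀ i, A i) →ₗ⁅k⁆ B), Function.Surjective f → LieAlgebra.IsSolvable B) ∧
    ((∀ i, Module.rank k (A i) ≤ Cardinal.continuum) → SmallIndexOrDimensions k A) ∧
    ((∀ i, FiniteDimensional k (A i)) → SmallIndexOrDimensions k A) := by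
  have : Infinite k := Infinite.of_injective _ (Nat.cast_injective (R := k))
  refine ⟨fun _ B _ _ _ f hf => LieAlgebra.isSolvable_of_surjective_pi A hA f hf,
    smallIndexOrDimensions_of_rank_le_continuum A, fun h => ?_⟩
  exact smallIndexOrDimensions_of_rank_le_continuum A fun i =>
    (Module.rank_lt_aleph0 k (A i)).le.trans Cardinal.aleph0_le_continuum
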